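/- Let $n,k,s$ be positive integers with $n\ge ks$ and $$n \ge (2s-1)(k-1)-s+2 .$$ (For $k\ge 3$ the condition $n\ge ks$ follows from the second inequality.) Let $H$ be a $k$-uniform hypergraph on $n$ vertices (a family of $k$-element subsets, called edges, of an $n$-element vertex set $V(H)$) whose minimum vertex degree $\delta_1(H)$, i.e. the minimum over $v\in V(H)$ of the number of edges containing $v$, satisfies $$\delta_1(H) > \binom{n-1}{k-1}-\binom{n-s}{k-1}.$$ Then $\nu^*(H)\ge s$, where the fractional matching number $\nu^*(H)$ is the maximum of $\sum_{e\in E(H)} w(e)$ over all fractional matchings of $H$, i.e. all functions $w:E(H)\to[0,1]$ such that $\sum_{e\ni v} w(e)\le 1$ for every $v\in V(H)$. -/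

import Mathlib

namespace Hypergraph

variable {α : Type*}

/-- `H` is `k`-uniform if every edge has exactly `k` vertices. -/
def IsUniform (H : Hypergraph α) (k : ℕ) : Prop :=
  ∀ e ∈ H.edgeSet, e.encard = k

/-- The degree of a set `S` of vertices: the number of edges containing `S` as a subset. -/
noncomputable def setDegree (H : Hypergraph α) (S : Set α) : ℕ :=
  {e ∈ H.edgeSet | S ⊆ e}.ncard

/-- The minimum `d`-degree `δ_d(H)`: the minimum of the degrees of the `d`-subsets of the
vertex set. In particular `H.minDegree 1` is the minimum vertex degree. -/
noncomputable def minDegree (H : Hypergraph α) (d : ℕ) : ℕ :=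
  sInf (H.setDegree '' {S | S ⊆ H.vertexSet ∧ S.encard = d})

/-- A fractional matching: a weight in `[0, 1]` on each edge such that at every vertex the
weights of the edges containing it sum to at most `1`. -/
structure IsFractionalMatching (H : Hypergraph α) (w : H.edgeSet → ℝ) : Prop where
  mem_Icc : ∀ e, w e ∈ Set.Icc (0 : ℝ) 1
  sum_le_one : ∀ v ∈ H.vertexSet, ∑ᶠ (e : H.edgeSet) (_ : v ∈ (e : Set α)), w e ≤ 1

/-- The set of sizes (total weights) of the fractional matchings of `H`. -/
def fractionalMatchingSizes (H : Hypergraph α) : Set ℝ :=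
  {x | ∃ w : H.edgeSet → ℝ, H.IsFractionalMatching w ∧ ∑ᶠ e, w e = x}

/-- The fractional matching number `ν*(H)`: the size of a largest fractional matching. For a
finite hypergraph the supremum is a maximum, see
`Hypergraph.isGreatest_fractionalMatchingNumber`. -/
noncomputable def fractionalMatchingNumber (H : Hypergraph α) : ℝ :=
  sSup H.fractionalMatchingSizes

theorem finite_edgeSet_of_finite_vertexSet (H : Hypergraph α) (hV : H.vertexSet.Finite) :
    H.edgeSet.Finite :=
  hV.finite_subsets.subset fun _ he => H.subset_vertexSet_of_mem_edgeSet' he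

/-- In a finite hypergraph, `ν*(H)` is attained by a fractional matching. -/
theorem isGreatest_fractionalMatchingNumber (H : Hypergraph α) (hV : H.vertexSet.Finite) :
    IsGreatest H.fractionalMatchingSizes H.fractionalMatchingNumber := by
  classical
  have : Finite H.edgeSet := H.finite_edgeSet_of_finite_vertexSet hV
  have : Fintype H.edgeSet := Fintype.ofFinite _
  have hc : IsCompact {w : H.edgeSet → ℝ | H.IsFractionalMatching w} := by
    have h1 : {w : H.edgeSet → ℝ | H.IsFractionalMatching w} =
        (Set.univ.pi fun _ => Set.Icc (0 : ℝ) 1) ∩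
          ⋂ v ∈ H.vertexSet, {w | ∑ e : H.edgeSet, (if v ∈ (e : Set α) then w e else 0) ≤ 1} := by
      ext w
      simp only [Set.mem_ofPred_eq, Set.mem_inter_iff, Set.mem_univ_pi, Set.mem_iInter]
      have key : ∀ v, ∑ᶠ (e : H.edgeSet) (_ : v ∈ (e : Set α)), w e =
          ∑ e : H.edgeSet, (if v ∈ (e : Set α) then w e else 0) := by
        intro v
        rw [finsum_eq_sum_of_fintype]
        exact Finset.sum_congr rfl fun e _ => finsum_eq_if
      constructor
      · rintro ⟨h, h'⟩
        exact ⟨h, fun v hv => key v ▸ h' v hv⟩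
      · rintro ⟨h, h'⟩
        exact ⟨h, fun v hv => (key v).symm ▸ h' v hv⟩
    rw [h1]
    refine (isCompact_univ_pi fun _ => isCompact_Icc).inter_right ?_
    refine isClosed_biInter fun v _ => isClosed_le ?_ continuous_const
    refine continuous_finsetSum _ fun e _ => ?_
    split_ifs
    · exact continuous_apply e
    · exact continuous_const
  have himg : H.fractionalMatchingSizes =
      (fun w : H.edgeSet → ℝ => ∑ e, w e) '' {w | H.IsFractionalMatching w} := by
    ext x
    simp only [fractionalMatchingSizes, finsum_eq_sum_of_fintype, Set.mem_image, Set.mem_ofPred_eq]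
  have hc' : IsCompact H.fractionalMatchingSizes := by
    rw [himg]
    exact hc.image (continuous_finsetSum _ fun e _ => continuous_apply e)
  refine hc'.isGreatest_sSup ⟨_, fun _ => 0, ⟨fun _ => by simp, fun v _ => by simp⟩, rfl⟩

end Hypergraph

open Finset

/-! If `ν* < s`, LP duality gives a fractional cover `w` of total weight below `s`. Let `v` be a
lightest vertex. Edges through `v` give `(k-1)`-sets `f` of the other vertices with `w(f) + w(v) ≥
1`. Subtracting `w(v)` from every weight turns this into `f` having weight at least `θ = 1 - k
w(v)`, and `n ≥ ks` keeps the new total below `sθ`. Such a threshold family obeys Frankl's matching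
bound, contradicting the degree hypothesis.

For the bound (`card_heavy_add_choose_le`, total below `(s+1)θ`), let `T` be the `s+1` heaviest
vertices, `t₀` the lightest of these, and `R` the rest. A weighted shadow inequality bounds the
heavy sets inside `R` by `s` times the link of `t₀` in `R`. Hall's theorem, averaged over `2s+1`
disjoint blocks, bounds all links of `T` plus `s` extra copies of the link of `t₀`. Together they
leave enough light sets meeting `T` at most once. -/

theorem exists_heaviest_subset {α : Type*} [DecidableEq α] (V : Finset α) (w : α → ℝ) (s : ℕ)
    (hs : s + 1 ≤ #V) :
    ∃ T ⊆ V, #T = s + 1 ∧ ∃ t₀ ∈ T, (∀ t ∈ T, w t₀ ≤ w t) ∧ ∀ x ∈ V \ T, w x ≤ w t₀ := by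
  induction s with
  | zero =>
    obtain ⟨x, hx, hmax⟩ := V.exists_max_image w (card_pos.1 (by omega))
    exact ⟨{x}, by simpa, by simp, x, by simp, by simp, fun y hy => hmax y (mem_sdiff.1 hy).1⟩
  | succ s ih =>
    obtain ⟨T, hTV, hT, t₀, ht₀, h1, h2⟩ := ih (by omega)
    have hne : (V \ T).Nonempty := card_pos.1 (by rw [card_sdiff_of_subset hTV]; omega)
    obtain ⟨x, hx, hmax⟩ := (V \ T).exists_max_image w hne
    rw [mem_sdiff] at hx
    refine ⟨insert x T, insert_subset hx.1 hTV, by rw [card_insert_of_notMem hx.2, hT], x,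
      mem_insert_self _ _, ?_, ?_⟩
    · intro t ht
      rcases mem_insert.1 ht with rfl | ht
      · exact le_rfl
      · exact (h2 x (mem_sdiff.2 hx)).trans (h1 t ht)
    · intro y hy
      simp only [mem_sdiff, mem_insert, not_or] at hy
      exact hmax y (mem_sdiff.2 ⟨hy.1, hy.2.2⟩)

/-! ### Averaging over disjoint blocks -/

theorem exists_perm_map_eq {β : Type*} [Fintype β] [DecidableEq β] (A B : Finset β)
    (h : #A = #B) : ∃ τ : Equiv.Perm β, A.map τ.toEmbedding = B := by
  obtain e : {x // x ∈ A} ≃ {x // x ∈ B} := Finset.equivOfCardEq h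
  refine ⟨e.extendSubtype, ?_⟩
  apply eq_of_subset_of_card_le
  · intro y hy
    obtain ⟨x, hx, rfl⟩ := mem_map.1 hy
    exact e.extendSubtype_mem x hx
  · rw [card_map, h]

/-- The symmetric group is transitive on `l`-sets, so the left sum is the same for every choice of
`B`; sum over all `B` and exchange the sums. -/
theorem card_choose_mul_sum_perm {β : Type*} [Fintype β] [DecidableEq β] (l : ℕ)
    (φ : Finset β → ℝ) (B : Finset β) (hB : #B = l) :
    ((Fintype.card β).choose l : ℝ) * ∑ σ : Equiv.Perm β, φ (B.map σ.toEmbedding) =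
      (Fintype.card (Equiv.Perm β) : ℝ) * ∑ g ∈ powersetCard l univ, φ g := by
  have h1 : ∀ B' ∈ powersetCard l (univ : Finset β),
      ∑ σ : Equiv.Perm β, φ (B'.map σ.toEmbedding) =
        ∑ σ : Equiv.Perm β, φ (B.map σ.toEmbedding) := by
    intro B' hB'
    obtain ⟨τ, rfl⟩ := exists_perm_map_eq B B' (by rw [hB, (mem_powersetCard.1 hB').2])
    rw [← Equiv.sum_comp (Equiv.mulRight τ) (fun σ => φ (B.map σ.toEmbedding))]
    refine sum_congr rfl fun σ _ => ?_
    rw [map_map]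
    rfl
  have h2 : ∀ σ : Equiv.Perm β, ∑ B' ∈ powersetCard l (univ : Finset β),
      φ (B'.map σ.toEmbedding) = ∑ g ∈ powersetCard l univ, φ g := by
    intro σ
    conv_rhs => rw [← map_univ_equiv σ, powersetCard_map, sum_map]
    rfl
  have h3 := sum_congr rfl h1
  rw [sum_comm, sum_congr rfl fun σ _ => h2 σ] at h3
  simp only [sum_const, card_powersetCard, card_univ, nsmul_eq_mul] at h3
  exact h3.symm

theorem exists_disjoint_blocks {β : Type*} [Fintype β] [DecidableEq β] (l q : ℕ)
    (h : q * l ≤ Fintype.card β) :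
    ∃ B : Fin q → Finset β, (∀ j, #(B j) = l) ∧ Pairwise fun i j => Disjoint (B i) (B j) := by
  obtain ⟨f⟩ : Nonempty (Fin q × Fin l ↪ β) :=
    Function.Embedding.nonempty_of_card_le (by simpa using h)
  refine ⟨fun j => (univ : Finset (Fin l)).map ⟨fun i => f (j, i), fun a b hab => by
    simpa using f.injective hab⟩, by simp, ?_⟩
  intro i j hij
  rw [disjoint_left]
  intro x hx hx'
  simp only [mem_map, mem_univ, true_and] at hx hx'
  obtain ⟨a, rfl⟩ := hx
  obtain ⟨b, hb⟩ := hx'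
  have := f.injective hb
  simp only [Prod.mk.injEq] at this
  exact hij this.1.symm

/-- Apply the hypothesis to every permuted copy of one block system; each block is then
equidistributed over the `l`-sets. -/
theorem sum_powersetCard_univ_le_of_blocks {β : Type*} [Fintype β] [DecidableEq β] (l q : ℕ)
    (hq : 0 < q) (h : q * l ≤ Fintype.card β) (φ : Finset β → ℝ) (C : ℝ)
    (hφ : ∀ B : Fin q → Finset β, (∀ j, #(B j) = l) →
      (Pairwise fun i j => Disjoint (B i) (B j)) → ∑ j, φ (B j) ≤ q * C) :
    ∑ g ∈ powersetCard l univ, φ g ≤ (Fintype.card β).choose l * C := by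
  obtain ⟨B, hB, hd⟩ := exists_disjoint_blocks (β := β) l q h
  have h1 : ∑ σ : Equiv.Perm β, ∑ j, φ ((B j).map σ.toEmbedding) ≤
      ∑ _σ : Equiv.Perm β, (q : ℝ) * C := by
    refine sum_le_sum fun σ _ => hφ (fun j => (B j).map σ.toEmbedding) (by simpa using hB) ?_
    intro i j hij
    exact (disjoint_map _).2 (hd hij)
  rw [sum_comm] at h1
  have h2 := mul_le_mul_of_nonneg_left h1 (Nat.cast_nonneg' (α := ℝ) ((Fintype.card β).choose l))
  rw [mul_sum, sum_congr rfl fun j _ => card_choose_mul_sum_perm l φ (B j) (hB j)] at h2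
  simp only [sum_const, card_univ, nsmul_eq_mul, Fintype.card_fin] at h2
  have hp : (0 : ℝ) < Fintype.card (Equiv.Perm β) := by exact_mod_cast Fintype.card_pos
  have hq' : (0 : ℝ) < q := by exact_mod_cast hq
  refine le_of_mul_le_mul_left ?_ (mul_pos hq' hp)
  linarith

/-- Averaging over blocks: a bound for the sum of `φ` over any `q` disjoint `l`-subsets of `R`
gives a bound for the sum of `φ` over all `l`-subsets of `R`. -/
theorem sum_powersetCard_le_of_blocks {α : Type*} [DecidableEq α] (R : Finset α) (l q : ℕ)
    (hq : 0 < q) (h : q * l ≤ #R) (φ : Finset α → ℝ) (C : ℝ)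
    (hφ : ∀ B : Fin q → Finset α, (∀ j, B j ⊆ R) → (∀ j, #(B j) = l) →
      (Pairwise fun i j => Disjoint (B i) (B j)) → ∑ j, φ (B j) ≤ q * C) :
    ∑ g ∈ powersetCard l R, φ g ≤ (#R).choose l * C := by
  have key := sum_powersetCard_univ_le_of_blocks (β := R) l q hq (by simpa using h)
    (fun g => φ (g.map (Function.Embedding.subtype _))) C (by
      intro B hB hd
      refine hφ (fun j => (B j).map (Function.Embedding.subtype _)) ?_ (by simpa using hB) ?_
      · intro j x hx
        obtain ⟨y, _, rfl⟩ := mem_map.1 hx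
        exact y.2
      · intro i j hij
        exact (disjoint_map _).2 (hd hij))
  have hR : (univ : Finset R).map (Function.Embedding.subtype _) = R := attach_map_val
  rw [Fintype.card_coe] at key
  refine le_trans (le_of_eq ?_) key
  conv_lhs => rw [← hR, powersetCard_map, sum_map]
  rfl

/-- If the sets `N i ⊆ Fin (2 * s + 1)`, indexed by `s + 1` elements, have no system of distinct
representatives and `N i₀` is contained in all of them, then their sizes are small on average. -/
theorem sum_card_le_of_not_injective {ι : Type*} [DecidableEq ι] (T : Finset ι) (s : ℕ)
    (hT : #T = s + 1) (N : T → Finset (Fin (2 * s + 1))) (i₀ : T) (hN : ∀ i, N i₀ ⊆ N i)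
    (hinj : ¬ ∃ f : T → Fin (2 * s + 1), Function.Injective f ∧ ∀ i, f i ∈ N i) :
    ∑ i, #(N i) + s * #(N i₀) ≤ (2 * s + 1) * s := by
  rw [← Finset.all_card_le_biUnion_card_iff_exists_injective] at hinj
  push Not at hinj
  obtain ⟨A, hA⟩ := hinj
  have hA0 : 0 < #A := by omega
  have hAs : #A ≤ s + 1 := by
    simpa [hT] using card_le_univ A
  obtain ⟨b, hb⟩ : ∃ b, #A = b + 1 := ⟨#A - 1, by omega⟩
  have h1 : ∀ i ∈ A, #(N i) ≤ b := fun i hi => by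
    have := card_le_card (subset_biUnion_of_mem N hi)
    omega
  have h0 : #(N i₀) ≤ b := by
    obtain ⟨i, hi⟩ := card_pos.1 hA0
    exact (card_le_card (hN i)).trans (h1 i hi)
  have h2 : ∀ i ∈ Aᶜ, #(N i) ≤ 2 * s + 1 := fun i _ => by
    simpa using card_le_univ (N i)
  have h3 := sum_le_card_nsmul _ _ _ h1
  have h4 := sum_le_card_nsmul _ _ _ h2
  rw [card_compl, Fintype.card_coe, hT] at h4
  -- The total is at most `(b+1)b + c(2s+1) + sb`, and `b ≤ s` gives `(b+1)b + sb ≤ (2s+1)b`; this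
  -- is where `2s+1` blocks are needed.
  obtain ⟨c, hc⟩ : ∃ c, s = b + c := ⟨s - b, by omega⟩
  rw [← sum_add_sum_compl A]
  have h5 : s + 1 - #A = c := by omega
  rw [h5] at h4
  rw [hb] at h3
  simp only [smul_eq_mul] at h3 h4
  subst hc
  nlinarith [Nat.mul_le_mul_left (b + c) h0]

/-! ### Frankl's bound for threshold families -/

section

variable {α : Type*} [DecidableEq α]

/-- Weighted shadow inequality: the `(l + 1)`-subsets of `R` of weight at least `θ` are compared
with the `l`-subsets which reach weight `θ` after adding `a`, an upper bound for the weights. -/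
theorem card_heavy_le_mul_card_shadow (R : Finset α) (w : α → ℝ) (a b θ : ℝ) (l : ℕ)
    (hθ : 0 < θ) (hw : ∀ x ∈ R, 0 ≤ w x) (ha : ∀ x ∈ R, w x ≤ a)
    (hsum : ∑ x ∈ R, w x + a ≤ (b + 1) * θ) :
    (#{e ∈ R.powersetCard (l + 1) | θ ≤ ∑ x ∈ e, w x} : ℝ) ≤
      b * #{f ∈ R.powersetCard l | θ ≤ ∑ x ∈ f, w x + a} := by
  set F := {e ∈ R.powersetCard (l + 1) | θ ≤ ∑ x ∈ e, w x}
  set G := {f ∈ R.powersetCard l | θ ≤ ∑ x ∈ f, w x + a}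
  have h1 : #F * θ ≤ ∑ e ∈ F, ∑ x ∈ e, w x := by
    rw [← nsmul_eq_mul]
    exact card_nsmul_le_sum _ _ _ fun e he => (mem_filter.1 he).2
  have h2 : ∑ f ∈ G, ∑ x ∈ R \ f, w x ≤ #G * (b * θ) := by
    rw [← nsmul_eq_mul]
    refine sum_le_card_nsmul _ _ _ fun f hf => ?_
    simp only [G, mem_filter, mem_powersetCard] at hf
    have := sum_sdiff (f := w) hf.1.1
    linarith [hf.2]
  -- Double count by moving `x` out of `e`: `(e, x) ↦ (e \ {x}, x)` is injective, and `e \ {x}` lies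
  -- in `G` because `w x ≤ a`.
  have h3 : ∑ e ∈ F, ∑ x ∈ e, w x ≤ ∑ f ∈ G, ∑ x ∈ R \ f, w x := by
    rw [sum_sigma', sum_sigma']
    let g : (Σ _ : Finset α, α) → (Σ _ : Finset α, α) := fun p => ⟨p.1.erase p.2, p.2⟩
    have hinj : Set.InjOn g (F.sigma fun e => e) := by
      rintro ⟨e, x⟩ hp ⟨e', x'⟩ hp' h
      simp only [coe_sigma, Set.mem_sigma_iff, mem_coe] at hp hp'
      simp only [g, Sigma.mk.injEq, heq_eq_eq] at h
      obtain ⟨h, rfl⟩ := h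
      rw [← insert_erase hp.2, h, insert_erase hp'.2]
    rw [← sum_image (g := g) (f := fun p => w p.2) hinj]
    refine sum_le_sum_of_subset_of_nonneg ?_ ?_
    · rintro p hp
      obtain ⟨⟨e, x⟩, hq, rfl⟩ := mem_image.1 hp
      simp only [F, mem_sigma, mem_filter, mem_powersetCard] at hq
      obtain ⟨⟨⟨heR, hec⟩, hew⟩, hx⟩ := hq
      have hxa := ha x (heR hx)
      have := sum_erase_add e w hx
      simp only [g, G, mem_sigma, mem_filter, mem_powersetCard, mem_sdiff]
      refine ⟨⟨⟨(erase_subset _ _).trans heR, by rw [card_erase_of_mem hx, hec]; rfl⟩, ?_⟩,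
        heR hx, by simp⟩
      linarith
    · rintro ⟨f, x⟩ hp _
      exact hw x (mem_sdiff.1 (mem_sigma.1 hp).2).1
  refine le_of_mul_le_mul_right ?_ hθ
  linarith

/-- Distinct disjoint blocks matched to all of `T` would give `s+1` disjoint heavy sets, exceeding
the total weight. Hall's condition therefore fails in every block system, and averaging gives the
bound. -/
theorem sum_card_link_le (R T : Finset α) (w : α → ℝ) (t₀ : α) (θ : ℝ) (s l : ℕ)
    (hT : #T = s + 1) (ht₀ : t₀ ∈ T) (hmin : ∀ t ∈ T, w t₀ ≤ w t)
    (hR : (2 * s + 1) * l ≤ #R) (hw : ∀ x ∈ R, 0 ≤ w x)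
    (hsum : ∑ x ∈ R, w x + ∑ x ∈ T, w x < (s + 1) * θ) :
    ∑ t ∈ T, #{f ∈ R.powersetCard l | θ ≤ ∑ x ∈ f, w x + w t} +
      s * #{f ∈ R.powersetCard l | θ ≤ ∑ x ∈ f, w x + w t₀} ≤ (#R).choose l * s := by
  let χ : Finset α → α → ℝ := fun f t => if θ ≤ ∑ x ∈ f, w x + w t then 1 else 0
  have hχ : ∀ t, ∑ f ∈ R.powersetCard l, χ f t =
      #{f ∈ R.powersetCard l | θ ≤ ∑ x ∈ f, w x + w t} := fun t => by simp [χ]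
  have key := sum_powersetCard_le_of_blocks R l (2 * s + 1) (by omega) hR
    (fun f => ∑ t ∈ T, χ f t + s * χ f t₀) s ?_
  · rw [sum_add_distrib, ← mul_sum, sum_comm, hχ, sum_congr rfl fun t _ => hχ t] at key
    exact_mod_cast key
  intro B hBR hB hd
  have hNN := sum_card_le_of_not_injective T s hT
    (fun t => {j | θ ≤ ∑ x ∈ B j, w x + w t}) ⟨t₀, ht₀⟩ ?_ ?_
  · have hc : ∀ t, ∑ j, χ (B j) t =
      #{j : Fin (2 * s + 1) | θ ≤ ∑ x ∈ B j, w x + w t} := fun t => by simp [χ]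
    rw [sum_add_distrib, ← mul_sum, sum_comm, hc, sum_congr rfl fun t _ => hc t]
    rw [sum_coe_sort T (fun t => #{j : Fin (2 * s + 1) | θ ≤ ∑ x ∈ B j, w x + w t})] at hNN
    exact_mod_cast hNN
  · intro t j hj
    simp only [mem_filter, mem_univ, true_and] at hj ⊢
    linarith [hmin t t.2]
  · rintro ⟨f, hf, hfN⟩
    simp only [mem_filter, mem_univ, true_and] at hfN
    have h1 := card_nsmul_le_sum univ (fun t : T => ∑ x ∈ B (f t), w x + w t) θ
      fun t _ => hfN t
    rw [card_univ, Fintype.card_coe, hT, nsmul_eq_mul, sum_add_distrib, sum_coe_sort T w,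
      ← sum_biUnion fun t _ t' _ h => hd (hf.ne h)] at h1
    have h2 : ∑ x ∈ univ.biUnion fun t : T => B (f t), w x ≤ ∑ x ∈ R, w x :=
      sum_le_sum_of_subset_of_nonneg (biUnion_subset.2 fun t _ => hBR _) fun x hx _ => hw x hx
    push_cast at h1
    linarith

/-- Only light sets meeting `T` in at most one vertex are counted; `(t, f) ↦ insert t f` is
injective because `f` avoids `T`. -/
theorem card_light_add_le (V T : Finset α) (w : α → ℝ) (θ : ℝ) (l : ℕ) (hTV : T ⊆ V) :
    #{e ∈ (V \ T).powersetCard (l + 1) | ¬ θ ≤ ∑ x ∈ e, w x} +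
      ∑ t ∈ T, #{f ∈ (V \ T).powersetCard l | ¬ θ ≤ ∑ x ∈ f, w x + w t} ≤
      #{e ∈ V.powersetCard (l + 1) | ¬ θ ≤ ∑ x ∈ e, w x} := by
  rw [← card_sigma]
  set P := T.sigma fun t => {f ∈ (V \ T).powersetCard l | ¬ θ ≤ ∑ x ∈ f, w x + w t}
  have hP : ∀ p ∈ P, p.1 ∈ T ∧ p.2 ⊆ V \ T ∧ #p.2 = l ∧ ¬ θ ≤ ∑ x ∈ p.2, w x + w p.1 := by
    intro p hp
    simpa [P, and_assoc] using hp
  have hnot : ∀ p ∈ P, ∀ t ∈ T, t ∉ p.2 := fun p hp t ht h =>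
    (mem_sdiff.1 ((hP p hp).2.1 h)).2 ht
  let g : (Σ _ : α, Finset α) → Finset α := fun p => insert p.1 p.2
  have hinj : Set.InjOn g P := by
    intro p hp q hq h
    have h1 : p.1 = q.1 := by
      have : p.1 ∈ g q := h ▸ mem_insert_self _ _
      exact (mem_insert.1 this).resolve_right (hnot q hq _ (hP p hp).1)
    have h2 : p.2 = q.2 := by
      rw [← erase_insert (hnot p hp _ (hP p hp).1), ← erase_insert (hnot q hq _ (hP q hq).1)]
      change (g p).erase p.1 = (g q).erase q.1
      rw [h, h1]
    exact Sigma.ext h1 (heq_of_eq h2)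
  rw [← card_image_of_injOn hinj, ← card_union_of_disjoint]
  · refine card_le_card (union_subset ?_ ?_)
    · exact filter_subset_filter _ (powersetCard_mono sdiff_subset)
    · intro e he
      obtain ⟨p, hp, rfl⟩ := mem_image.1 he
      have hn := hnot p hp _ (hP p hp).1
      obtain ⟨h1, h2, h3, h4⟩ := hP p hp
      simp only [g, mem_filter, mem_powersetCard]
      refine ⟨⟨insert_subset (hTV h1) (h2.trans sdiff_subset), by
        rw [card_insert_of_notMem hn, h3]⟩, ?_⟩
      rw [sum_insert hn, add_comm]
      exact h4
  · rw [disjoint_left]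
    intro e he he'
    obtain ⟨p, hp, rfl⟩ := mem_image.1 he'
    have := (mem_powersetCard.1 (mem_filter.1 he).1).1 (mem_insert_self p.1 p.2)
    exact (mem_sdiff.1 this).2 (hP p hp).1

/-- Frankl's bound for the family of all `(l + 1)`-sets of weight at least `θ`. -/
theorem card_heavy_add_choose_le (V : Finset α) (w : α → ℝ) (θ : ℝ) (s l : ℕ)
    (hV : (2 * s + 1) * l + (s + 1) ≤ #V) (hw : ∀ x ∈ V, 0 ≤ w x)
    (hsum : ∑ x ∈ V, w x < (s + 1) * θ) :
    #{e ∈ V.powersetCard (l + 1) | θ ≤ ∑ x ∈ e, w x} + (#V - s).choose (l + 1) ≤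
      (#V).choose (l + 1) := by
  obtain ⟨T, hTV, hT, t₀, ht₀, hmin, hmax⟩ := exists_heaviest_subset V w s (by omega)
  have hR : #(V \ T) = #V - (s + 1) := by rw [card_sdiff_of_subset hTV, hT]
  have hsplit := sum_sdiff (f := w) hTV
  have hwR : ∀ x ∈ V \ T, 0 ≤ w x := fun x hx => hw x (mem_sdiff.1 hx).1
  have hθ : 0 < θ := by
    have : 0 < (s + 1) * θ := (sum_nonneg hw).trans_lt hsum
    exact pos_of_mul_pos_right this (by positivity)
  have ht₀T : w t₀ ≤ ∑ x ∈ T, w x :=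
    single_le_sum (fun x hx => hw x (hTV hx)) ht₀
  have hB := card_heavy_le_mul_card_shadow (V \ T) w (w t₀) s θ l hθ hwR hmax (by linarith)
  have hB' : #{e ∈ (V \ T).powersetCard (l + 1) | θ ≤ ∑ x ∈ e, w x} ≤
      s * #{f ∈ (V \ T).powersetCard l | θ ≤ ∑ x ∈ f, w x + w t₀} := by exact_mod_cast hB
  have hC := sum_card_link_le (V \ T) T w t₀ θ s l hT ht₀ hmin (by omega) hwR
    (by linarith)
  have hE := card_light_add_le V T w θ l hTV
  have h1 := card_filter_add_card_filter_not (s := (V \ T).powersetCard (l + 1))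
    (fun e => θ ≤ ∑ x ∈ e, w x)
  have h2 := card_filter_add_card_filter_not (s := V.powersetCard (l + 1))
    (fun e => θ ≤ ∑ x ∈ e, w x)
  have h3 : ∑ t ∈ T, #{f ∈ (V \ T).powersetCard l | θ ≤ ∑ x ∈ f, w x + w t} +
      ∑ t ∈ T, #{f ∈ (V \ T).powersetCard l | ¬ θ ≤ ∑ x ∈ f, w x + w t} =
      (s + 1) * (#(V \ T)).choose l := by
    rw [← sum_add_distrib, sum_congr rfl fun t _ => card_filter_add_card_filter_not _]
    simp [hT]
  rw [card_powersetCard] at h1 h2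
  have h4 : (#V - s).choose (l + 1) = (#(V \ T)).choose l + (#(V \ T)).choose (l + 1) := by
    rw [← Nat.choose_succ_succ, hR]
    congr 1
    omega
  rw [h4]
  nlinarith

end

/-! ### Linear programming duality -/

/-- Linear programming duality for packing and covering, as a theorem of the alternative. -/
theorem exists_packing_or_covering {ι κ : Type*} [Fintype ι] [Fintype κ] (A : ι → κ → ℝ) (s : ℝ)
    (hs : 0 < s) :
    (∃ f : ι → ℝ, (∀ e, 0 ≤ f e) ∧ ∑ e, f e = s ∧ ∀ v, ∑ e, A e v * f e ≤ 1) ∨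
      ∃ g : κ → ℝ, (∀ v, 0 ≤ g v) ∧ ∑ v, g v < s ∧ ∀ e, 1 ≤ ∑ v, A e v * g v := by
  classical
  let L : (ι → ℝ) →ₗ[ℝ] (κ → ℝ) :=
    { toFun := fun f v => ∑ e, A e v * (s * f e)
      map_add' := fun f f' => by
        ext v
        simp only [Pi.add_apply, mul_add, sum_add_distrib]
      map_smul' := fun c f => by
        ext v
        simp only [Pi.smul_apply, smul_eq_mul, RingHom.id_apply, mul_sum]
        exact sum_congr rfl fun e _ => by ring }
  have hL : ∀ f v, L f v = ∑ e, A e v * (s * f e) := fun _ _ => rfl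
  have hLc : Continuous L := L.continuous_of_finiteDimensional
  let D : Set (κ → ℝ) := Set.Iic 1
  -- Either some packing of total `s` satisfies all constraints, or a hyperplane separates the
  -- orthant `y ≤ 1` from all candidates.
  by_cases hD : Disjoint D (L '' stdSimplex ℝ ι)
  · right
    obtain ⟨φ, u, v, hφD, huv, hφK⟩ := geometric_hahn_banach_closed_compact (convex_Iic 1)
      isClosed_Iic ((convex_stdSimplex ℝ ι).linear_image L)
      ((isCompact_stdSimplex ℝ ι).image hLc) hD
    let g : κ → ℝ := fun x => φ (Pi.single x 1)
    have hφ : ∀ y, φ y = ∑ x, y x * g x := by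
      intro y
      conv_lhs => rw [pi_eq_sum_univ' y]
      simp [g, map_sum]
    -- The orthant is unbounded below, so a negative coefficient would make `φ` unbounded above on
    -- it.
    have hg : ∀ x, 0 ≤ g x := by
      intro x
      by_contra! hneg
      have hφ1 : φ 1 < u := hφD 1 (Set.mem_Iic.2 le_rfl)
      have h := hφD (1 - ((u - φ 1) / (-g x)) • Pi.single x (1 : ℝ)) (by
        have h0 : (0 : κ → ℝ) ≤ ((u - φ 1) / (-g x)) • Pi.single x (1 : ℝ) :=
          smul_nonneg (div_nonneg (by linarith) (by linarith)) (by simp)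
        simpa using h0)
      rw [map_sub, map_smul] at h
      change φ 1 - (u - φ 1) / (-g x) * g x < u at h
      have : (u - φ 1) / (-g x) * g x = -(u - φ 1) := by
        field_simp [hneg.ne]
      linarith
    have hsum : ∑ x, g x < u := by
      have := hφD 1 (Set.mem_Iic.2 le_rfl)
      rw [hφ] at this
      simpa using this
    have hu : 0 < u := (sum_nonneg fun x _ => hg x).trans_lt hsum
    refine ⟨fun x => s / u * g x, fun x => mul_nonneg (by positivity) (hg x), ?_, ?_⟩
    · rw [← mul_sum, div_mul_eq_mul_div, div_lt_iff₀ hu]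
      exact mul_lt_mul_of_pos_left hsum hs
    · intro e
      have h := hφK _ ⟨Pi.single e 1, single_mem_stdSimplex ℝ e, rfl⟩
      rw [hφ] at h
      have h2 : ∀ x, L (Pi.single e 1) x = A e x * s := by
        intro x
        rw [hL, sum_eq_single e] <;> simp +contextual
      simp only [h2] at h
      have h3 : ∑ x, A e x * (s / u * g x) = (∑ x, A e x * s * g x) / u := by
        rw [sum_div]
        exact sum_congr rfl fun x _ => by ring
      rw [h3, le_div_iff₀ hu]
      linarith
  · left
    obtain ⟨_, hy, f, hf, rfl⟩ := Set.not_disjoint_iff.1 hD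
    refine ⟨fun e => s * f e, fun e => mul_nonneg hs.le (hf.1 e), ?_, fun v => hy v⟩
    rw [← mul_sum, hf.2, mul_one]

/-! ### Fractional covers and vertex degrees -/

namespace Hypergraph

variable {α : Type*}

open Classical in
theorem exists_fractionalCover_of_fractionalMatchingNumber_lt (H : Hypergraph α)
    (hV : H.vertexSet.Finite) (hne : ∀ e ∈ H.edgeSet, e.Nonempty) (s : ℝ) (hs : 0 < s)
    (h : H.fractionalMatchingNumber < s) :
    ∃ w : α → ℝ, (∀ x, 0 ≤ w x) ∧ ∑ x ∈ hV.toFinset, w x < s ∧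
      ∀ e ∈ H.edgeSet, 1 ≤ ∑ x ∈ hV.toFinset with x ∈ e, w x := by
  have : Finite H.edgeSet := H.finite_edgeSet_of_finite_vertexSet hV
  have : Fintype H.edgeSet := Fintype.ofFinite _
  obtain ⟨f, hf0, hfs, hf1⟩ | ⟨g, hg0, hgs, hg1⟩ := exists_packing_or_covering
    (fun (e : H.edgeSet) (x : hV.toFinset) => if (x : α) ∈ (e : Set α) then (1 : ℝ) else 0) s hs
  · exfalso
    simp only [ite_mul, one_mul, zero_mul] at hf1
    refine h.not_ge ((H.isGreatest_fractionalMatchingNumber hV).2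
      ⟨f, ⟨fun e => ⟨hf0 e, ?_⟩, fun v hv => ?_⟩, by rw [finsum_eq_sum_of_fintype, hfs]⟩)
    -- A vertex of `e` is needed to get `f e ≤ 1` from a vertex constraint.
    · obtain ⟨x, hx⟩ := hne e e.2
      refine le_trans ?_
        (hf1 ⟨x, hV.mem_toFinset.2 (H.subset_vertexSet_of_mem_edgeSet' e.2 hx)⟩)
      refine le_trans (le_of_eq ?_) (single_le_sum (fun e' _ => ?_) (mem_univ e))
      · rw [if_pos hx]
      · split_ifs
        exacts [hf0 e', le_rfl]
    · rw [finsum_eq_sum_of_fintype]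
      refine le_trans (le_of_eq ?_) (hf1 ⟨v, hV.mem_toFinset.2 hv⟩)
      exact sum_congr rfl fun e _ => finsum_eq_if
  · let w : α → ℝ := fun x => if hx : x ∈ hV.toFinset then g ⟨x, hx⟩ else 0
    have hw : ∀ x : hV.toFinset, w x = g x := fun x => dif_pos x.2
    refine ⟨w, fun x => ?_, ?_, fun e he => ?_⟩
    · dsimp only [w]
      split_ifs
      exacts [hg0 _, le_rfl]
    · rw [← sum_coe_sort]
      simpa only [hw] using hgs
    · rw [sum_filter, ← sum_coe_sort]
      simpa only [hw, ite_mul, one_mul, zero_mul] using hg1 ⟨e, he⟩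

theorem minDegree_one_le_setDegree_singleton (H : Hypergraph α) {v : α} (hv : v ∈ H.vertexSet) :
    H.minDegree 1 ≤ H.setDegree {v} :=
  Nat.sInf_le ⟨{v}, ⟨by simpa, by simp⟩, rfl⟩

open Classical in
/-- If every edge has weight at least `1` under `w`, then the degree of `v` is at most the number
of `l`-subsets of `V \ {v}` which reach weight `1` after adding `v`. -/
theorem setDegree_singleton_le_card (H : Hypergraph α) (hV : H.vertexSet.Finite) (l : ℕ)
    (hH : H.IsUniform (l + 1)) (w : α → ℝ)
    (hw : ∀ e ∈ H.edgeSet, 1 ≤ ∑ x ∈ hV.toFinset with x ∈ e, w x) (v : α) :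
    H.setDegree {v} ≤
      #{f ∈ (hV.toFinset.erase v).powersetCard l | 1 ≤ ∑ x ∈ f, w x + w v} := by
  rw [setDegree, ← Set.ncard_coe_finset]
  refine Set.ncard_le_ncard_of_injOn (fun e => {x ∈ hV.toFinset | x ∈ e}.erase v) ?_ ?_
    (finite_toSet _)
  · rintro e ⟨he, hve⟩
    have hve : v ∈ e := hve rfl
    have heV := H.subset_vertexSet_of_mem_edgeSet' he
    have hvf : v ∈ ({x ∈ hV.toFinset | x ∈ e} : Finset α) := by simp [hve, heV hve]
    have hcoe : (({x ∈ hV.toFinset | x ∈ e} : Finset α) : Set α) = e := by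
      ext x
      simpa using fun h => heV h
    have hcard : #({x ∈ hV.toFinset | x ∈ e} : Finset α) = l + 1 := by
      have := hH e he
      rw [← hcoe, Set.encard_coe_eq_coe_finsetCard] at this
      exact_mod_cast this
    simp only [mem_coe, mem_filter, mem_powersetCard]
    refine ⟨⟨erase_subset_erase _ (filter_subset _ _), ?_⟩, ?_⟩
    · rw [card_erase_of_mem hvf, hcard, Nat.add_sub_cancel]
    · rw [sum_erase_add _ _ hvf]
      exact hw e he
  · rintro e ⟨he, hve⟩ e' ⟨he', hve'⟩ h
    ext x
    have hx := Finset.ext_iff.1 h x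
    simp only [mem_erase, mem_filter, Set.Finite.mem_toFinset] at hx
    by_cases hxv : x = v
    · subst hxv
      exact iff_of_true (hve rfl) (hve' rfl)
    · have h1 : x ∈ e → x ∈ H.vertexSet := fun h => H.subset_vertexSet_of_mem_edgeSet' he h
      have h2 : x ∈ e' → x ∈ H.vertexSet := fun h => H.subset_vertexSet_of_mem_edgeSet' he' h
      tauto

end Hypergraph

theorem mainTheorem4 {α : Type*} (n k s : ℕ) (hk : 1 ≤ k) (hs : 1 ≤ s) (hks : k * s ≤ n)
    (hn : (n : ℤ) ≥ (2 * (s : ℤ) - 1) * ((k : ℤ) - 1) - (s : ℤ) + 2)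
    (H : Hypergraph α) (hV : H.vertexSet.encard = n) (hH : H.IsUniform k)
    (hdeg : (H.minDegree 1 : ℤ) > ((n - 1).choose (k - 1) : ℤ) - ((n - s).choose (k - 1) : ℤ)) :
    H.fractionalMatchingNumber ≥ (s : ℝ) := by
  classical
  have hfin : H.vertexSet.Finite := Set.finite_of_encard_eq_coe hV
  have hcard : #hfin.toFinset = n := by
    rw [hfin.encard_eq_coe_toFinset_card] at hV
    exact_mod_cast hV
  obtain ⟨l, rfl⟩ : ∃ l, k = l + 1 := ⟨k - 1, by omega⟩
  obtain ⟨s, rfl⟩ : ∃ s', s = s' + 1 := ⟨s - 1, by omega⟩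
  by_contra! hlt
  obtain ⟨w, hw0, hws, hwe⟩ := H.exists_fractionalCover_of_fractionalMatchingNumber_lt hfin
    (fun e he => by
      rw [← Set.encard_ne_zero, hH e he]
      simp) _ (by positivity) hlt
  have hn1 : 1 ≤ n := le_trans (Nat.mul_pos (by omega) (by omega)) hks
  obtain ⟨v, hv, hmin⟩ := hfin.toFinset.exists_min_image w (card_pos.1 (by omega))
  have hd := (H.minDegree_one_le_setDegree_singleton (hfin.mem_toFinset.1 hv)).trans
    (H.setDegree_singleton_le_card hfin l hH w hwe v)
  have hVv : #(hfin.toFinset.erase v) = n - 1 := by rw [card_erase_of_mem hv, hcard]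
  have hsv := sum_erase_add _ w hv
  have hnv : ((l : ℝ) + 1) * (s + 1) ≤ n := by exact_mod_cast hks
  simp only [Nat.add_sub_cancel, Nat.cast_add, Nat.cast_one] at hn hdeg hws
  suffices #{f ∈ (hfin.toFinset.erase v).powersetCard l | 1 ≤ ∑ x ∈ f, w x + w v} +
      (n - (s + 1)).choose l ≤ (n - 1).choose l by omega
  -- Uniformity one is separate: the links are `0`-sets, while Frankl's bound concerns `(l+1)`-sets.
  rcases l with _ | l
  · suffices ¬ 1 ≤ w v by simpa
    intro h1
    have := card_nsmul_le_sum hfin.toFinset w 1 fun x hx => h1.trans (hmin x hx)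
    rw [hcard, nsmul_eq_mul] at this
    push_cast at hnv
    linarith
  -- Minimality of `w v` keeps the shifted weights nonnegative; the edge size is now `l + 2`.
  · have hheavy := card_heavy_add_choose_le (hfin.toFinset.erase v) (fun x => w x - w v)
      (1 - (l + 2) * w v) s l ?_ ?_ ?_
    · rw [hVv, Nat.sub_sub, add_comm 1 s] at hheavy
      refine le_trans (Nat.add_le_add_right (card_le_card ?_) _) hheavy
      intro f hf
      simp only [mem_filter] at hf ⊢
      refine ⟨hf.1, ?_⟩
      rw [sum_sub_distrib, sum_const, (mem_powersetCard.1 hf.1).2, nsmul_eq_mul]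
      push_cast
      linarith [hf.2]
    · rw [hVv]
      have hz : (((2 * s + 1) * l + (s + 1) : ℕ) : ℤ) ≤ ((n - 1 : ℕ) : ℤ) := by
        push_cast [hn1]
        push_cast at hn
        linarith
      exact_mod_cast hz
    · intro x hx
      linarith [hmin x (mem_of_mem_erase hx)]
    · rw [sum_sub_distrib, sum_const, hVv, nsmul_eq_mul, Nat.cast_sub hn1]
      push_cast at hnv ⊢
      nlinarith [mul_le_mul_of_nonneg_right hnv (hw0 v)]
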